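/- Let $G$ be a connected undirected graph without loops on the agents $\{1,\dots,n\}$, $n\ge 1$. Let $A=[a_{ij}]\in\mathbb{R}^{n\times n}$ be a random weight matrix which almost surely satisfies: $A$ is symmetric; for $i\ne j$, $a_{ij}\neq 0$ if and only if $\{i,j\}$ is an edge of $G$; one eigenvalue of $A$ (counted with multiplicity) equals $1$ and all the others have modulus $<1$; and $A\mathbf{1}=\mathbf{1}$. Assume that the joint law of the edge weights $(a_{ij})_{i<j,\ \{i,j\}\in E(G)}$ is absolutely continuous with respect to Lebesgue measure on $\mathbb{R}^{E(G)}$; "almost surely" refers to this random choice of the weights. Let $i_1,\dots,i_p$ be distinct agents (the attackers), $B=[e_{i_1},\dots,e_{i_p}]$, and let $C$ be the $m\times n$ matrix whose rows are $e_j^\top$ for $j=1$ and for the neighbours $j$ of agent $1$. For $0<\varphi<1$ and a realization $v(k)\in\mathbb{R}^n$, $k\in\mathbb{N}=\{0,1,\dots\}$, of the privacy randomness (in the model, independent standard normal variables $v_i(k)$), put $w(0)=v(0)$ and $w(k)=\varphi^kv(k)-\varphi^{k-1}v(k-1)$ for $k\ge1$. With initial state $x(0)\in\mathbb{R}^n$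 and attack input $u=(u(k))_{k\in\mathbb{N}}$, $u(k)\in\mathbb{R}^p$, consider $$x(k+1)=A\,(x(k)+w(k))+Bu(k),\qquad y(k)=C\,(x(k)+w(k)).$$ Write $y^{0+a}(x_0,u,k)$ for the part of $y(k)$ generated by the initial state $x(0)=x_0$ and the input $u$, that is, $y(k)$ minus the part of $y(k)$ generated by the noise alone (the output for $x(0)=0$, $u\equiv 0$ and the same noise). For $N\ge 0$ let $\mathcal{O}_N$ be the matrix with block rows $C,CA,\dots,CA^N$, and let $\mathcal{J}_N$ be the $(N+1)\times(N+1)$ block matrix whose block in block row $i$ and block column $l$ ($0\le i,l\le N$) is $CA^{i-1-l}B$ if $l<i$ and $\mathbf{0}$ otherwise. Let $\mathcal{P}=I_{m(n+1)}-\mathcal{O}_n\mathcal{O}_n^+$, where $^+$ is the Moore–Penrose pseudoinverse. The residual vector of the attack detector is $r(k)=\mathcal{P}\,[y(k)^\top,\dots,y(k+n)^\top]^\top$, and $r^a(x_0,u,k)$ is $r(k)$, for initial state $x_0$ and input $u$, minus the part of $r(k)$ generated by the noise alone. An input $u$ is *undetectable* if there are $x_1,x_2\in\mathbb{R}^n$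 with $y^{0+a}(x_1,u,k)=y^{0+a}(x_2,0,k)$ for all $k\in\mathbb{N}$. It is *undetectable by the attack detector* if there are $x_1,x_2\in\mathbb{R}^n$ with $r^a(x_1,u,k)=r^a(x_2,0,k)$ for all $k\in\mathbb{N}$. Then, almost surely, for all choices of the attackers $i_1,\dots,i_p$ (and of $p$), all $0<\varphi<1$ and all realizations $v$, the following statements are equivalent: 1. there is no nonzero undetectable input $u$; 2. there is no nonzero input $u$ that is undetectable by the attack detector; 3. $\operatorname{rank}\begin{bmatrix}\mathcal{O}_{n-1}&\mathcal{J}_{n-1}\end{bmatrix}-\operatorname{rank}\mathcal{J}_{n-1}=n$. -/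

import Mathlib

open MeasureTheory

namespace Consensus

/-! ### The Moore--Penrose pseudoinverse of a real matrix -/

/-- The four Penrose equations. -/
structure IsMoorePenrose {ι κ : Type*} [Fintype ι] [Fintype κ]
    (M : Matrix ι κ ℝ) (X : Matrix κ ι ℝ) : Prop where
  mul_mul : M * X * M = M
  mul_mul' : X * M * X = X
  symm_left : (M * X).transpose = M * X
  symm_right : (X * M).transpose = X * M

theorem exists_isMoorePenrose {ι κ : Type*} [Fintype ι] [Fintype κ] (M : Matrix ι κ ℝ) :
    ∃ X : Matrix κ ι ℝ, IsMoorePenrose M X := by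
  classical
  have hS : (M.transpose * M).IsHermitian := by
    unfold Matrix.IsHermitian
    rw [Matrix.conjTranspose_eq_transpose_of_trivial, Matrix.transpose_mul,
      Matrix.transpose_transpose]
  obtain ⟨G, hGt, hSGS, hGSG, hGS⟩ : ∃ G : Matrix κ κ ℝ, G.transpose = G ∧
      (M.transpose * M) * G * (M.transpose * M) = M.transpose * M ∧
      G * (M.transpose * M) * G = G ∧ G * (M.transpose * M) = (M.transpose * M) * G := by
    obtain ⟨U, d, hUU, hspec⟩ : ∃ (U : Matrix κ κ ℝ) (d : κ → ℝ), star U * U = 1 ∧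
        M.transpose * M = U * Matrix.diagonal d * star U := by
      refine ⟨hS.eigenvectorUnitary.1, hS.eigenvalues,
        Unitary.coe_star_mul_self hS.eigenvectorUnitary, ?_⟩
      conv_lhs => rw [hS.spectral_theorem, Unitary.conjStarAlgAut_apply]
      rfl
    rw [hspec]
    have key : ∀ d e : κ → ℝ, (U * Matrix.diagonal d * star U) * (U * Matrix.diagonal e * star U)
        = U * Matrix.diagonal (fun i => d i * e i) * star U := by
      intro d e
      calc (U * Matrix.diagonal d * star U) * (U * Matrix.diagonal e * star U)
          = U * Matrix.diagonal d * (star U * U) * Matrix.diagonal e * star U := by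
            simp only [mul_assoc]
        _ = _ := by rw [hUU, mul_one, mul_assoc U, Matrix.diagonal_mul_diagonal]
    refine ⟨U * Matrix.diagonal (fun i => (d i)⁻¹) * star U, ?_, ?_, ?_, ?_⟩
    · rw [Matrix.star_eq_conjTranspose, Matrix.conjTranspose_eq_transpose_of_trivial]
      simp [Matrix.transpose_mul, mul_assoc]
    · rw [key, key]
      congr 3
      ext i
      by_cases h : d i = 0 <;> simp [h]
    · rw [key, key]
      congr 3
      ext i
      by_cases h : d i = 0 <;> simp [h]
    · rw [key, key]
      congr 3
      ext i
      exact mul_comm _ _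
  refine ⟨G * M.transpose, ?_, ?_, ?_, ?_⟩
  · rw [← sub_eq_zero, ← Matrix.conjTranspose_mul_self_eq_zero,
      Matrix.conjTranspose_eq_transpose_of_trivial]
    have h1 : M * (G * M.transpose) * M - M = M * (G * (M.transpose * M) - 1) := by
      rw [Matrix.mul_sub, Matrix.mul_one]; simp only [Matrix.mul_assoc]
    have h2 : (M.transpose * M) * (G * (M.transpose * M) - 1) = 0 := by
      rw [Matrix.mul_sub, Matrix.mul_one, ← Matrix.mul_assoc, hSGS, sub_self]
    rw [h1, Matrix.transpose_mul, Matrix.mul_assoc, ← Matrix.mul_assoc M.transpose, h2,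
      Matrix.mul_zero]
  · calc G * M.transpose * M * (G * M.transpose)
        = G * (M.transpose * M) * G * M.transpose := by simp only [Matrix.mul_assoc]
      _ = _ := by rw [hGSG]
  · simp only [Matrix.transpose_mul, Matrix.transpose_transpose, hGt, Matrix.mul_assoc]
  · rw [Matrix.mul_assoc, Matrix.transpose_mul, Matrix.transpose_mul, Matrix.transpose_transpose,
      hGt, hGS]

/-- The Moore--Penrose pseudoinverse `M⁺`. -/
noncomputable def pinv {ι κ : Type*} [Fintype ι] [Fintype κ] (M : Matrix ι κ ℝ) :
    Matrix κ ι ℝ :=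
  (exists_isMoorePenrose M).choose

theorem pinv_spec {ι κ : Type*} [Fintype ι] [Fintype κ] (M : Matrix ι κ ℝ) :
    IsMoorePenrose M (pinv M) :=
  (exists_isMoorePenrose M).choose_spec

/-! ### The network -/

/-- `A` is an admissible weight matrix for the network `G`: it is symmetric, its off-diagonal
entries are nonzero exactly on the edges of `G`, one eigenvalue (counted with multiplicity) is `1`
and all others have modulus less than `1`, and `A 𝟏 = 𝟏`. -/
structure IsWeightMatrix {n : ℕ} (G : SimpleGraph (Fin n)) (A : Matrix (Fin n) (Fin n) ℝ) :
    Prop where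
  symm : A.IsHermitian
  support : ∀ i j, i ≠ j → (A i j ≠ 0 ↔ G.Adj i j)
  spectral : ∃ i, symm.eigenvalues i = 1 ∧ ∀ j, j ≠ i → |symm.eigenvalues j| < 1
  ones : A.mulVec (fun _ => 1) = fun _ => 1

/-- The (undirected) edges of `G`, each one listed once, as a pair with increasing entries. -/
abbrev Edge {n : ℕ} (G : SimpleGraph (Fin n)) : Type :=
  {e : Fin n × Fin n // e.1 < e.2 ∧ G.Adj e.1 e.2}

/-- The vector of edge weights of `A`. -/
def edgeWeights {n : ℕ} (G : SimpleGraph (Fin n)) (A : Matrix (Fin n) (Fin n) ℝ) : Edge G → ℝ :=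
  fun e => A e.1.1 e.1.2

/-- The agents whose broadcasts agent `s` sees: itself and its neighbours. -/
abbrev Visible {n : ℕ} (G : SimpleGraph (Fin n)) (s : Fin n) : Type :=
  {j : Fin n // j = s ∨ G.Adj s j}

/-- The observation matrix `C` of agent `s`; its rows are the `eⱼᵀ` with `j` visible to `s`. -/
def obsC {n : ℕ} (G : SimpleGraph (Fin n)) (s : Fin n) : Matrix (Visible G s) (Fin n) ℝ :=
  Matrix.of fun c j => if c.1 = j then 1 else 0

/-- The attack matrix `B = [e_{i₁}, …, e_{iₚ}]`. -/
def attackB {n p : ℕ} (atk : Fin p → Fin n) : Matrix (Fin n) (Fin p) ℝ :=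
  Matrix.of fun j l => if atk l = j then 1 else 0

/-! ### The system with privacy noise -/

/-- The privacy noise `w(0) = v(0)`, `w(k) = φᵏ v(k) - φᵏ⁻¹ v(k-1)` for `k ≥ 1`. -/
def privacyNoise {n : ℕ} (φ : ℝ) (v : ℕ → Fin n → ℝ) : ℕ → Fin n → ℝ
  | 0 => v 0
  | k + 1 => φ ^ (k + 1) • v (k + 1) - φ ^ k • v k

section System

variable {n p : ℕ} {Y : Type*}

/-- The state: `x(k+1) = A (x(k) + w(k)) + B u(k)`. -/
def state (A : Matrix (Fin n) (Fin n) ℝ) (B : Matrix (Fin n) (Fin p) ℝ)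
    (w : ℕ → Fin n → ℝ) (x₀ : Fin n → ℝ) (u : ℕ → Fin p → ℝ) : ℕ → Fin n → ℝ
  | 0 => x₀
  | k + 1 => A.mulVec (state A B w x₀ u k + w k) + B.mulVec (u k)

/-- The observation: `y(k) = C (x(k) + w(k))`. -/
def output (A : Matrix (Fin n) (Fin n) ℝ) (B : Matrix (Fin n) (Fin p) ℝ)
    (C : Matrix Y (Fin n) ℝ) (w : ℕ → Fin n → ℝ) (x₀ : Fin n → ℝ) (u : ℕ → Fin p → ℝ) (k : ℕ) :
    Y → ℝ :=
  C.mulVec (state A B w x₀ u k + w k)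

/-- The part of `y(k)` generated by the initial state and the attack input: what remains of `y(k)`
after removing the part generated by the noise alone. -/
def outputZA (A : Matrix (Fin n) (Fin n) ℝ) (B : Matrix (Fin n) (Fin p) ℝ)
    (C : Matrix Y (Fin n) ℝ) (w : ℕ → Fin n → ℝ) (x₀ : Fin n → ℝ) (u : ℕ → Fin p → ℝ) (k : ℕ) :
    Y → ℝ :=
  output A B C w x₀ u k - output A B C w 0 0 k

/-- By superposition, that part is the response of the system without noise. -/
theorem outputZA_eq_noiseless (A : Matrix (Fin n) (Fin n) ℝ) (B : Matrix (Fin n) (Fin p) ℝ)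
    (C : Matrix Y (Fin n) ℝ) (w : ℕ → Fin n → ℝ) (x₀ : Fin n → ℝ) (u : ℕ → Fin p → ℝ) (k : ℕ) :
    outputZA A B C w x₀ u k = output A B C 0 x₀ u k := by
  have h : ∀ k, state A B w x₀ u k = state A B 0 x₀ u k + state A B w 0 0 k := by
    intro k
    induction k with
    | zero => simp [state]
    | succ k ih =>
      simp only [state, ih, Matrix.mulVec_add, Pi.zero_apply, Matrix.mulVec_zero, add_zero]
      abel
  simp only [outputZA, output, h, Matrix.mulVec_add, Pi.zero_apply, add_zero]
  abel

/-- `𝒪_N`, with block rows `C, CA, …, CA^N`. -/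
def obsMatrix (A : Matrix (Fin n) (Fin n) ℝ) (C : Matrix Y (Fin n) ℝ) (N : ℕ) :
    Matrix (Fin (N + 1) × Y) (Fin n) ℝ :=
  Matrix.of fun r j => (C * A ^ (r.1 : ℕ)) r.2 j

/-- `𝒥_N`, an `(N+1) × (N+1)` block matrix: the block in block row `i` and block column `l` is
`C A^(i-1-l) B` if `l < i`, and zero otherwise. -/
def inputMatrix (A : Matrix (Fin n) (Fin n) ℝ) (B : Matrix (Fin n) (Fin p) ℝ)
    (C : Matrix Y (Fin n) ℝ) (N : ℕ) :
    Matrix (Fin (N + 1) × Y) (Fin (N + 1) × Fin p) ℝ :=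
  Matrix.of fun r c =>
    if (c.1 : ℕ) < r.1 then (C * A ^ ((r.1 : ℕ) - 1 - c.1) * B) r.2 c.2 else 0

/-- `𝒫 = I - 𝒪_n 𝒪_n⁺`, where `n` is the number of agents. -/
noncomputable def projP [Fintype Y] [DecidableEq Y] (A : Matrix (Fin n) (Fin n) ℝ)
    (C : Matrix Y (Fin n) ℝ) : Matrix (Fin (n + 1) × Y) (Fin (n + 1) × Y) ℝ :=
  1 - obsMatrix A C n * pinv (obsMatrix A C n)

/-- The residual `r(k) = 𝒫 Y_{[k,k+n]}` computed from an observation sequence `y`. -/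
noncomputable def residualVec [Fintype Y] [DecidableEq Y] (A : Matrix (Fin n) (Fin n) ℝ)
    (C : Matrix Y (Fin n) ℝ) (y : ℕ → Y → ℝ) (k : ℕ) : Fin (n + 1) × Y → ℝ :=
  (projP A C).mulVec fun r => y (k + r.1) r.2

/-- `rᵃ(x₀, u, k)`: what remains of the residual `r(k)` after removing the part `rⁿ(k)` generated
by the noise alone. -/
noncomputable def residualA [Fintype Y] [DecidableEq Y] (A : Matrix (Fin n) (Fin n) ℝ)
    (B : Matrix (Fin n) (Fin p) ℝ) (C : Matrix Y (Fin n) ℝ) (w : ℕ → Fin n → ℝ)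
    (x₀ : Fin n → ℝ) (u : ℕ → Fin p → ℝ) (k : ℕ) : Fin (n + 1) × Y → ℝ :=
  residualVec A C (output A B C w x₀ u) k - residualVec A C (output A B C w 0 0) k

/-- The attack input `u` is undetectable. -/
def Undetectable (A : Matrix (Fin n) (Fin n) ℝ) (B : Matrix (Fin n) (Fin p) ℝ)
    (C : Matrix Y (Fin n) ℝ) (w : ℕ → Fin n → ℝ) (u : ℕ → Fin p → ℝ) : Prop :=
  ∃ x₁ x₂ : Fin n → ℝ, ∀ k, outputZA A B C w x₁ u k = outputZA A B C w x₂ 0 k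

/-- The attack input `u` is undetectable by the attack detector. -/
def UndetectableByDetector [Fintype Y] [DecidableEq Y] (A : Matrix (Fin n) (Fin n) ℝ)
    (B : Matrix (Fin n) (Fin p) ℝ) (C : Matrix Y (Fin n) ℝ) (w : ℕ → Fin n → ℝ)
    (u : ℕ → Fin p → ℝ) : Prop :=
  ∃ x₁ x₂ : Fin n → ℝ, ∀ k, residualA A B C w x₁ u k = residualA A B C w x₂ 0 k

end System

end Consensus

/-!
The noise cancels by superposition, so everything concerns the noiseless responses of `(A, B, C)`.

The equivalences hold for every realization for which `(C, A)` is observable (`Observable.tfae`).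
The rank condition says that zero outputs over `n` steps force a zero initial state, whatever the
input; by shifting time, zero outputs then force a zero state forever, and `B` being injective the
input vanishes. Conversely, zero outputs over `n` steps can be prolonged to zero outputs forever by
a suitable input, because the chain of weakly unobservable subspaces is constant from index `n` on
(`exists_input_output_eq_zero`); if no nonzero input is undetectable, that input is zero, and
observability makes the initial state zero. As to the detector, a vanishing residual says that a
window of `n + 1` outputs is one of a free response. Consecutive windows share `n` outputs, which
determine the state, so the free responses of all windows form one trajectory, and the input is
undetectable.

Observability holds almost surely (`ae_observable`). The row sums make `A` equal to `1 - L` with `L`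
the Laplacian of the edge weights, so that observability is the nonvanishing of a Gram determinant
which is analytic in the edge weights. The zero set of an analytic function is a null set unless the
function vanishes identically (`ae_ne_zero_of_analyticOnNhd`), so one observable choice of weights
is enough. For it, `L` must have no nonzero eigenvector vanishing at the observing agent. Such
weights are found by growing a spanning tree from that agent: a new vertex attached by an edge of
small weight preserves the property (`Separating.exists_insert`), by a compactness argument.
-/

namespace Consensus


/-! ### Zero sets of real-analytic functions -/

/-- The zero set of a real-analytic function that is not identically zero is a null set. On every
line through a point `a` with `f a ≠ 0` the zeros of `f` are isolated; by Fubini some dilation about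
`a` therefore pulls the zero set back to a null set, and dilations preserve null sets. -/
theorem ae_ne_zero_of_analyticOnNhd {E : Type*} [NormedAddCommGroup E] [NormedSpace ℝ E]
    [FiniteDimensional ℝ E] [MeasurableSpace E] [BorelSpace E] (μ : Measure E)
    [μ.IsAddHaarMeasure] {f : E → ℝ} (hf : AnalyticOnNhd ℝ f Set.univ) {a : E} (ha : f a ≠ 0) :
    ∀ᵐ y ∂μ, f y ≠ 0 := by
  have := FiniteDimensional.proper ℝ E
  have hcont : Continuous f := by
    rw [← continuousOn_univ]; exact hf.continuousOn
  have hline : ∀ y : E, ∀ᵐ t : ℝ, f (AffineMap.homothety a t y) ≠ 0 := by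
    intro y
    have hg : AnalyticOnNhd ℝ (fun t : ℝ => f (AffineMap.homothety a t y)) Set.univ := by
      intro t _
      have h1 : AnalyticAt ℝ (fun t : ℝ => AffineMap.homothety a t y) t := by
        simp only [AffineMap.homothety_apply, vsub_eq_sub, vadd_eq_add]
        fun_prop
      exact (hf _ (Set.mem_univ _)).fun_comp h1
    have h0 := hg.preimage_zero_mem_codiscrete (x := 0) (by simpa using ha)
    have h1 := ae_restrict_le_codiscreteWithin (μ := (volume : Measure ℝ))
      (U := Set.univ) MeasurableSet.univ h0
    rw [Measure.restrict_univ] at h1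
    filter_upwards [h1] with t ht
    simpa using ht
  have hmeas : MeasurableSet {q : E × ℝ | f (AffineMap.homothety a q.2 q.1) ≠ 0} := by
    have : Continuous fun q : E × ℝ => f (AffineMap.homothety a q.2 q.1) := by
      simp only [AffineMap.homothety_apply, vsub_eq_sub, vadd_eq_add]
      fun_prop
    exact (isOpen_ne_fun this continuous_const).measurableSet
  have hswap := (Measure.ae_ae_comm (μ := μ) (ν := (volume : Measure ℝ))
    (p := fun y t => f (AffineMap.homothety a t y) ≠ 0) hmeas).1 (Filter.Eventually.of_forall hline)
  obtain ⟨t, ht, ht0⟩ := (hswap.and (Measure.ae_ne volume (0 : ℝ))).exists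
  rw [ae_iff] at ht ⊢
  have himg : {y | ¬ f y ≠ 0} =
      AffineMap.homothety a t '' {y | ¬ f (AffineMap.homothety a t y) ≠ 0} := by
    ext y
    simp only [Set.mem_image, Set.mem_ofPred_eq]
    constructor
    · intro hy
      have : AffineMap.homothety a t (AffineMap.homothety a t⁻¹ y) = y := by
        rw [← AffineMap.homothety_mul_apply, mul_inv_cancel₀ ht0, AffineMap.homothety_one]; rfl
      exact ⟨AffineMap.homothety a t⁻¹ y, by rwa [this], this⟩
    · rintro ⟨z, hz, rfl⟩
      exact hz
  rw [himg, Measure.addHaar_image_homothety, ht, mul_zero]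


/-! ### Noiseless responses and weakly unobservable states -/

section System

variable {n p : ℕ} {Y : Type*}

theorem state_noiseless_succ (A : Matrix (Fin n) (Fin n) ℝ) (B : Matrix (Fin n) (Fin p) ℝ)
    (x : Fin n → ℝ) (u : ℕ → Fin p → ℝ) (k : ℕ) :
    state A B 0 x u (k + 1) = state A B 0 (A.mulVec x + B.mulVec (u 0)) (fun j => u (j + 1)) k := by
  induction k with
  | zero => simp [state]
  | succ k ih => rw [state, ih]; rfl

theorem output_noiseless_succ (A : Matrix (Fin n) (Fin n) ℝ) (B : Matrix (Fin n) (Fin p) ℝ)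
    (C : Matrix Y (Fin n) ℝ) (x : Fin n → ℝ) (u : ℕ → Fin p → ℝ) (k : ℕ) :
    output A B C 0 x u (k + 1) =
      output A B C 0 (A.mulVec x + B.mulVec (u 0)) (fun j => u (j + 1)) k := by
  simp only [output, state_noiseless_succ, Pi.zero_apply]

theorem output_noiseless_zero (A : Matrix (Fin n) (Fin n) ℝ) (B : Matrix (Fin n) (Fin p) ℝ)
    (C : Matrix Y (Fin n) ℝ) (x : Fin n → ℝ) (u : ℕ → Fin p → ℝ) :
    output A B C 0 x u 0 = C.mulVec x := by
  simp [output, state]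

theorem state_noiseless_sub (A : Matrix (Fin n) (Fin n) ℝ) (B : Matrix (Fin n) (Fin p) ℝ)
    (x x' : Fin n → ℝ) (u u' : ℕ → Fin p → ℝ) (k : ℕ) :
    state A B 0 x u k - state A B 0 x' u' k = state A B 0 (x - x') (u - u') k := by
  induction k with
  | zero => rfl
  | succ k ih =>
    simp only [state, ← ih, Pi.zero_apply, add_zero, Matrix.mulVec_sub, Pi.sub_apply]
    abel

theorem output_noiseless_sub (A : Matrix (Fin n) (Fin n) ℝ) (B : Matrix (Fin n) (Fin p) ℝ)
    (C : Matrix Y (Fin n) ℝ) (x x' : Fin n → ℝ) (u u' : ℕ → Fin p → ℝ) (k : ℕ) :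
    output A B C 0 x u k - output A B C 0 x' u' k = output A B C 0 (x - x') (u - u') k := by
  simp only [output, Pi.zero_apply, add_zero, ← state_noiseless_sub, Matrix.mulVec_sub]

theorem state_noiseless_eq_sum (A : Matrix (Fin n) (Fin n) ℝ) (B : Matrix (Fin n) (Fin p) ℝ)
    (x : Fin n → ℝ) (u : ℕ → Fin p → ℝ) (k : ℕ) :
    state A B 0 x u k =
      (A ^ k).mulVec x + ∑ l ∈ Finset.range k, (A ^ (k - 1 - l) * B).mulVec (u l) := by
  induction k with
  | zero => simp [state]
  | succ k ih =>
    rw [state, ih, Finset.sum_range_succ]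
    simp only [Pi.zero_apply, add_zero, Matrix.mulVec_add, Matrix.mulVec_mulVec, ← pow_succ',
      Matrix.mulVec_sum, ← Matrix.mul_assoc]
    have h1 : ∑ l ∈ Finset.range k, (A ^ (k - 1 - l + 1) * B).mulVec (u l) =
        ∑ l ∈ Finset.range k, (A ^ (k + 1 - 1 - l) * B).mulVec (u l) := by
      refine Finset.sum_congr rfl fun l hl => ?_
      have := Finset.mem_range.1 hl
      rw [show k - 1 - l + 1 = k + 1 - 1 - l by omega]
    rw [h1, add_tsub_cancel_right, tsub_self, pow_zero, Matrix.one_mul, add_assoc]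

theorem output_noiseless_zero_input (A : Matrix (Fin n) (Fin n) ℝ) (B : Matrix (Fin n) (Fin p) ℝ)
    (C : Matrix Y (Fin n) ℝ) (x : Fin n → ℝ) (k : ℕ) :
    output A B C 0 x 0 k = (C * A ^ k).mulVec x := by
  simp [output, state_noiseless_eq_sum]

/-- The stacked matrix `[𝒪_N 𝒥_N]` computes the first `N + 1` noiseless outputs. -/
theorem obsMatrix_mulVec_add_inputMatrix_mulVec (A : Matrix (Fin n) (Fin n) ℝ)
    (B : Matrix (Fin n) (Fin p) ℝ) (C : Matrix Y (Fin n) ℝ) (N : ℕ) (x : Fin n → ℝ)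
    (u : ℕ → Fin p → ℝ) (i : Fin (N + 1)) (y : Y) :
    ((obsMatrix A C N).mulVec x +
      (inputMatrix A B C N).mulVec (fun c => u c.1 c.2)) (i, y) = output A B C 0 x u i y := by
  have h1 : (obsMatrix A C N).mulVec x (i, y) = ((C * A ^ (i : ℕ)).mulVec x) y := rfl
  have h2 : (inputMatrix A B C N).mulVec (fun c => u c.1 c.2) (i, y) =
      ∑ l ∈ Finset.range i, ((C * A ^ ((i : ℕ) - 1 - l) * B).mulVec (u l)) y := by
    have h3 : (inputMatrix A B C N).mulVec (fun c => u c.1 c.2) (i, y) =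
        ∑ l : Fin (N + 1), if (l : ℕ) < i then
          ((C * A ^ ((i : ℕ) - 1 - l) * B).mulVec (u l)) y else 0 := by
      simp only [Matrix.mulVec, dotProduct, inputMatrix, Matrix.of_apply, Fintype.sum_prod_type]
      refine Finset.sum_congr rfl fun l _ => ?_
      split_ifs <;> simp
    rw [h3, Fin.sum_univ_eq_sum_range (fun l => if l < (i : ℕ) then
          ((C * A ^ ((i : ℕ) - 1 - l) * B).mulVec (u l)) y else 0) (N + 1),
      ← Finset.sum_filter]
    refine Finset.sum_congr ?_ fun _ _ => rfl
    ext l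
    have := i.2
    simp only [Finset.mem_filter, Finset.mem_range]
    omega
  rw [Pi.add_apply, h1, h2]
  simp only [output, state_noiseless_eq_sum, Pi.zero_apply, add_zero, Matrix.mulVec_add,
    Matrix.mulVec_sum, Matrix.mulVec_mulVec, Pi.add_apply, Finset.sum_apply, Matrix.mul_assoc]

/-- The states from which some input keeps the first `k` noiseless outputs equal to zero, defined by
the recursion `V₀ = ⊤`, `Vₖ₊₁ = ker C ∩ A⁻¹(Vₖ + im B)`. -/
noncomputable def weaklyUnobservable (A : Matrix (Fin n) (Fin n) ℝ) (B : Matrix (Fin n) (Fin p) ℝ)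
    (C : Matrix Y (Fin n) ℝ) : ℕ → Submodule ℝ (Fin n → ℝ)
  | 0 => ⊤
  | k + 1 => LinearMap.ker C.mulVecLin ⊓
      (weaklyUnobservable A B C k ⊔ LinearMap.range B.mulVecLin).comap A.mulVecLin

variable (A : Matrix (Fin n) (Fin n) ℝ) (B : Matrix (Fin n) (Fin p) ℝ) (C : Matrix Y (Fin n) ℝ)

theorem mem_weaklyUnobservable_succ {k : ℕ} {x : Fin n → ℝ} :
    x ∈ weaklyUnobservable A B C (k + 1) ↔
      C.mulVec x = 0 ∧ ∃ a, A.mulVec x + B.mulVec a ∈ weaklyUnobservable A B C k := by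
  simp only [weaklyUnobservable, Submodule.mem_inf, LinearMap.mem_ker, Matrix.mulVecLin_apply,
    Submodule.mem_comap, Submodule.mem_sup, LinearMap.mem_range]
  refine and_congr_right fun _ => ⟨?_, ?_⟩
  · rintro ⟨y, hy, _, ⟨a, rfl⟩, h⟩
    refine ⟨-a, ?_⟩
    rwa [← h, Matrix.mulVec_neg, add_neg_cancel_right]
  · rintro ⟨a, ha⟩
    exact ⟨_, ha, _, ⟨-a, rfl⟩, by rw [Matrix.mulVec_neg, add_neg_cancel_right]⟩

theorem mem_weaklyUnobservable_iff {k : ℕ} {x : Fin n → ℝ} :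
    x ∈ weaklyUnobservable A B C k ↔
      ∃ u : ℕ → Fin p → ℝ, ∀ j < k, output A B C 0 x u j = 0 := by
  induction k generalizing x with
  | zero => simp [weaklyUnobservable]
  | succ k ih =>
    rw [mem_weaklyUnobservable_succ]
    constructor
    · rintro ⟨hC, a, ha⟩
      obtain ⟨u, hu⟩ := ih.1 ha
      refine ⟨fun j => Nat.casesOn j a u, fun j hj => ?_⟩
      cases j with
      | zero => rwa [output_noiseless_zero]
      | succ j => rw [output_noiseless_succ]; exact hu j (by omega)
    · rintro ⟨u, hu⟩
      refine ⟨by simpa [output_noiseless_zero] using hu 0 (by omega), u 0,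
        ih.2 ⟨fun j => u (j + 1), fun j hj => ?_⟩⟩
      rw [← output_noiseless_succ]
      exact hu _ (by omega)

theorem weaklyUnobservable_succ_le (k : ℕ) :
    weaklyUnobservable A B C (k + 1) ≤ weaklyUnobservable A B C k := by
  intro x hx
  rw [mem_weaklyUnobservable_iff] at hx ⊢
  obtain ⟨u, hu⟩ := hx
  exact ⟨u, fun j hj => hu j (by omega)⟩

/-- The decreasing chain of weakly unobservable subspaces is constant from index `n` on: each strict
step lowers the dimension, and one equality propagates through the recursion. -/
theorem weaklyUnobservable_eq_succ :
    weaklyUnobservable A B C n = weaklyUnobservable A B C (n + 1) := by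
  have key : ∀ k, weaklyUnobservable A B C k = weaklyUnobservable A B C (k + 1) ∨
      Module.finrank ℝ (weaklyUnobservable A B C (k + 1)) + (k + 1) ≤ n := by
    have hlt : ∀ k, weaklyUnobservable A B C k = weaklyUnobservable A B C (k + 1) ∨
        Module.finrank ℝ (weaklyUnobservable A B C (k + 1)) <
          Module.finrank ℝ (weaklyUnobservable A B C k) := by
      intro k
      rcases (weaklyUnobservable_succ_le A B C k).eq_or_lt with h | h
      · exact Or.inl h.symm
      · exact Or.inr (Submodule.finrank_lt_finrank_of_lt h)
    intro k
    induction k with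
    | zero =>
      refine (hlt 0).imp_right fun h => ?_
      have := Submodule.finrank_le (weaklyUnobservable A B C 0)
      rw [Module.finrank_fin_fun] at this
      omega
    | succ k ih =>
      rcases ih with h | h
      · left
        rw [weaklyUnobservable, h]
        rfl
      · exact (hlt (k + 1)).imp_right fun h' => by omega
  exact (key n).resolve_right (by omega)

/-- If the first `n` outputs can be kept at zero, then all of them can: the input is chosen step by
step so that the state stays in the limit of the chain of weakly unobservable subspaces. -/
theorem exists_input_output_eq_zero {x : Fin n → ℝ} {u : ℕ → Fin p → ℝ}
    (h : ∀ j < n, output A B C 0 x u j = 0) :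
    ∃ u' : ℕ → Fin p → ℝ, ∀ j, output A B C 0 x u' j = 0 := by
  have hx : x ∈ weaklyUnobservable A B C n := (mem_weaklyUnobservable_iff A B C).2 ⟨u, h⟩
  have hV : ∀ z : weaklyUnobservable A B C n, C.mulVec z.1 = 0 ∧
      ∃ a, A.mulVec z.1 + B.mulVec a ∈ weaklyUnobservable A B C n := fun z =>
    (mem_weaklyUnobservable_succ A B C).1 (weaklyUnobservable_eq_succ A B C ▸ z.2)
  choose hC g hg using hV
  let s : ℕ → weaklyUnobservable A B C n := fun k => Nat.rec ⟨x, hx⟩ (fun _ z => ⟨_, hg z⟩) k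
  have hs : ∀ k, state A B 0 x (fun j => g (s j)) k = (s k).1 := by
    intro k
    induction k with
    | zero => rfl
    | succ k ih => rw [state, ih, Pi.zero_apply, add_zero]
  refine ⟨fun j => g (s j), fun j => ?_⟩
  rw [output, hs, Pi.zero_apply, add_zero, hC]

/-! ### Observability -/

/-- The pair `(C, A)` is observable: only the zero state has zero free response. -/
def Observable : Prop :=
  ∀ x : Fin n → ℝ, (∀ k, (C * A ^ k).mulVec x = 0) → x = 0

variable {A C}

/-- For an observable pair the first `n` free outputs determine the state. This is the special case
without inputs of the statement that zero outputs can be prolonged. -/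
theorem Observable.eq_zero (h : Observable A C) {x : Fin n → ℝ}
    (hx : ∀ k < n, (C * A ^ k).mulVec x = 0) : x = 0 := by
  obtain ⟨u', hu'⟩ := exists_input_output_eq_zero A (0 : Matrix (Fin n) (Fin 0) ℝ) C (x := x)
    (u := 0) (by simpa only [output_noiseless_zero_input] using hx)
  refine h x fun k => ?_
  rw [← hu' k, Subsingleton.elim u' 0, output_noiseless_zero_input]

theorem observable_iff_det_ne_zero [NeZero n] [Fintype Y] :
    Observable A C ↔
      ((obsMatrix A C (n - 1)).transpose * obsMatrix A C (n - 1)).det ≠ 0 := by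
  rw [← not_iff_not, not_not, ← Matrix.exists_mulVec_eq_zero_iff]
  have hn : n - 1 + 1 = n := Nat.sub_add_cancel NeZero.one_le
  have hker : ∀ x, ((obsMatrix A C (n - 1)).transpose * obsMatrix A C (n - 1)).mulVec x = 0 ↔
      ∀ k < n, (C * A ^ k).mulVec x = 0 := by
    intro x
    have h1 : ((obsMatrix A C (n - 1)).transpose * obsMatrix A C (n - 1)).mulVec x = 0 ↔
        (obsMatrix A C (n - 1)).mulVec x = 0 := by
      have := Matrix.ker_mulVecLin_transpose_mul_self (obsMatrix A C (n - 1))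
      exact SetLike.ext_iff.1 this x
    rw [h1]
    constructor
    · intro h k hk
      ext y
      exact congrFun h (⟨k, by omega⟩, y)
    · intro h
      ext ⟨k, y⟩
      exact congrFun (h k (by omega)) y
  simp only [hker]
  constructor
  · intro h
    simp only [Observable, not_forall] at h
    obtain ⟨x, hx, hx0⟩ := h
    exact ⟨x, hx0, fun k _ => hx k⟩
  · rintro ⟨x, hx0, hx⟩ h
    exact hx0 (h.eq_zero hx)

end System


/-! ### Undetectability for an observable pair -/

/-- The defect in the rank condition is `dim ker [M N] - dim ker N`, and `ker N` embeds into
`ker [M N]` as the vectors with zero first part. -/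
theorem rank_fromCols_sub_rank_eq_iff {ι κ₁ κ₂ : Type*} [Fintype ι] [Fintype κ₁] [Fintype κ₂]
    (M : Matrix ι κ₁ ℝ) (N : Matrix ι κ₂ ℝ) :
    ((Matrix.fromCols M N).rank : ℤ) - (N.rank : ℤ) = Fintype.card κ₁ ↔
      ∀ x z, M.mulVec x + N.mulVec z = 0 → x = 0 := by
  classical
  let F : (κ₁ → ℝ) × (κ₂ → ℝ) →ₗ[ℝ] (ι → ℝ) := M.mulVecLin.coprod N.mulVecLin
  have hF : (Matrix.fromCols M N).rank = Module.finrank ℝ (LinearMap.range F) := by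
    have : LinearMap.range (Matrix.fromCols M N).mulVecLin = LinearMap.range F := by
      ext y
      simp only [LinearMap.mem_range, Matrix.mulVecLin_apply, F, LinearMap.coprod_apply]
      constructor
      · rintro ⟨w, rfl⟩
        exact ⟨(w ∘ Sum.inl, w ∘ Sum.inr), (Matrix.fromCols_mulVec _ _ _).symm⟩
      · rintro ⟨w, rfl⟩
        exact ⟨Sum.elim w.1 w.2, by rw [Matrix.fromCols_mulVec]; rfl⟩
    rw [Matrix.rank, this]
  have h1 := LinearMap.finrank_range_add_finrank_ker F
  have h2 := LinearMap.finrank_range_add_finrank_ker N.mulVecLin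
  have hN : N.rank = Module.finrank ℝ (LinearMap.range N.mulVecLin) := rfl
  rw [Module.finrank_prod] at h1
  rw [Module.finrank_fintype_fun_eq_card] at h1 h2
  rw [Module.finrank_fintype_fun_eq_card] at h1
  have hle : Submodule.map (LinearMap.inr ℝ (κ₁ → ℝ) (κ₂ → ℝ)) (LinearMap.ker N.mulVecLin) ≤
      LinearMap.ker F := by
    rintro _ ⟨z, hz, rfl⟩
    simpa [F] using hz
  have hmap : Module.finrank ℝ
      (Submodule.map (LinearMap.inr ℝ (κ₁ → ℝ) (κ₂ → ℝ)) (LinearMap.ker N.mulVecLin)) =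
      Module.finrank ℝ (LinearMap.ker N.mulVecLin) :=
    (Submodule.equivMapOfInjective _ LinearMap.inr_injective _).finrank_eq.symm
  constructor
  · intro h x z hxz
    have heq := Submodule.eq_of_le_of_finrank_eq hle (by omega)
    have hmem : (x, z) ∈ LinearMap.ker F := by simpa [F] using hxz
    rw [← heq] at hmem
    obtain ⟨z', _, hz'⟩ := hmem
    exact (congrArg Prod.fst hz').symm
  · intro h
    have heq : Submodule.map (LinearMap.inr ℝ (κ₁ → ℝ) (κ₂ → ℝ)) (LinearMap.ker N.mulVecLin) =
        LinearMap.ker F := by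
      refine le_antisymm hle ?_
      rintro ⟨x, z⟩ hxz
      have hxz' : M.mulVec x + N.mulVec z = 0 := by simpa [F] using hxz
      obtain rfl := h x z hxz'
      exact ⟨z, by simpa using hxz', rfl⟩
    rw [heq] at hmap
    omega

section System

variable {n p : ℕ} {Y : Type*} (A : Matrix (Fin n) (Fin n) ℝ) (B : Matrix (Fin n) (Fin p) ℝ)
  (C : Matrix Y (Fin n) ℝ) (w : ℕ → Fin n → ℝ)

theorem undetectable_iff (u : ℕ → Fin p → ℝ) :
    Undetectable A B C w u ↔ ∃ x, ∀ k, output A B C 0 x u k = 0 := by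
  simp only [Undetectable, outputZA_eq_noiseless, ← sub_eq_zero (b := output A B C 0 _ 0 _),
    output_noiseless_sub, sub_zero]
  exact ⟨fun ⟨x₁, x₂, h⟩ => ⟨_, h⟩, fun ⟨x, h⟩ => ⟨x, 0, by simpa using h⟩⟩

variable [Fintype Y] [DecidableEq Y]

theorem projP_mulVec_eq_zero_iff (z : Fin (n + 1) × Y → ℝ) :
    (projP A C).mulVec z = 0 ↔ ∃ x, (obsMatrix A C n).mulVec x = z := by
  constructor
  · intro h
    rw [projP, Matrix.sub_mulVec, Matrix.one_mulVec, sub_eq_zero, ← Matrix.mulVec_mulVec] at h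
    exact ⟨_, h.symm⟩
  · rintro ⟨x, rfl⟩
    rw [projP, Matrix.mulVec_mulVec, Matrix.sub_mul, Matrix.one_mul, (pinv_spec _).mul_mul,
      sub_self, Matrix.zero_mulVec]

theorem residualVec_sub (y y' : ℕ → Y → ℝ) (k : ℕ) :
    residualVec A C y k - residualVec A C y' k = residualVec A C (y - y') k := by
  rw [residualVec, residualVec, ← Matrix.mulVec_sub]
  rfl

theorem residualA_eq_noiseless (x : Fin n → ℝ) (u : ℕ → Fin p → ℝ) (k : ℕ) :
    residualA A B C w x u k = residualVec A C (output A B C 0 x u) k := by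
  rw [residualA, residualVec_sub]
  congr 1
  ext k : 1
  exact outputZA_eq_noiseless A B C w x u k

/-- The detector misses `u` exactly when every window of `n + 1` consecutive noiseless outputs is a
window of some free response. -/
theorem undetectableByDetector_iff (u : ℕ → Fin p → ℝ) :
    UndetectableByDetector A B C w u ↔
      ∃ x, ∀ k, ∃ z, ∀ i ≤ n, output A B C 0 x u (k + i) = (C * A ^ i).mulVec z := by
  have hres : ∀ x k, residualVec A C (output A B C 0 x u) k = 0 ↔
      ∃ z, ∀ i ≤ n, output A B C 0 x u (k + i) = (C * A ^ i).mulVec z := by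
    intro x k
    rw [residualVec, projP_mulVec_eq_zero_iff]
    refine exists_congr fun z => ⟨fun h i hi => ?_, fun h => ?_⟩
    · ext y
      exact (congrFun h (⟨i, by omega⟩, y)).symm
    · ext ⟨i, y⟩
      exact (congrFun (h i (by omega)) y).symm
  have hsub : ∀ x x' k, output A B C 0 x u k - output A B C 0 x' 0 k =
      output A B C 0 (x - x') u k := fun x x' k => by rw [output_noiseless_sub, sub_zero]
  simp only [UndetectableByDetector, residualA_eq_noiseless, ← hres,
    ← sub_eq_zero (b := residualVec A C (output A B C 0 _ 0) _), residualVec_sub]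
  constructor
  · rintro ⟨x₁, x₂, h⟩
    refine ⟨x₁ - x₂, fun k => ?_⟩
    rw [← h k]
    congr 1
    ext k : 1
    exact (hsub _ _ _).symm
  · rintro ⟨x, h⟩
    refine ⟨x, 0, fun k => ?_⟩
    rw [← h k]
    congr 1
    ext k : 1
    exact (hsub _ _ _).trans (by rw [sub_zero])

variable {A C}

/-- For an observable pair, an input missed by the detector is undetectable. Consecutive windows
overlap in `n` outputs, which determine the state of a free response; hence the free responses
matched by the windows all belong to one trajectory of `A`. -/
theorem Observable.undetectable_of_undetectableByDetector (h : Observable A C)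
    {u : ℕ → Fin p → ℝ} (hu : UndetectableByDetector A B C w u) : Undetectable A B C w u := by
  rw [undetectableByDetector_iff] at hu
  rw [undetectable_iff]
  obtain ⟨x, hx⟩ := hu
  choose z hz using hx
  have hstep : ∀ k, z (k + 1) = A.mulVec (z k) := by
    intro k
    rw [← sub_eq_zero]
    refine h.eq_zero fun i hi => ?_
    rw [Matrix.mulVec_sub, Matrix.mulVec_mulVec, Matrix.mul_assoc, ← pow_succ, ← hz _ i (by omega),
      ← hz _ (i + 1) (by omega), sub_eq_zero]
    congr 1
    omega
  have hpow : ∀ k, z k = (A ^ k).mulVec (z 0) := by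
    intro k
    induction k with
    | zero => simp
    | succ k ih => rw [hstep, ih, Matrix.mulVec_mulVec, pow_succ']
  refine ⟨x - z 0, fun k => ?_⟩
  rw [← sub_zero u, ← output_noiseless_sub, output_noiseless_zero_input, ← Matrix.mulVec_mulVec,
    ← hpow, sub_eq_zero]
  simpa using hz k 0 (by omega)

theorem undetectableByDetector_of_undetectable {u : ℕ → Fin p → ℝ}
    (hu : Undetectable A B C w u) : UndetectableByDetector A B C w u := by
  rw [undetectable_iff] at hu
  rw [undetectableByDetector_iff]
  obtain ⟨x, hx⟩ := hu
  exact ⟨x, fun k => ⟨0, fun i _ => by simp [hx]⟩⟩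

end System

section System

variable {n p : ℕ} {Y : Type*} {A : Matrix (Fin n) (Fin n) ℝ} (B : Matrix (Fin n) (Fin p) ℝ)
  {C : Matrix Y (Fin n) ℝ} (w : ℕ → Fin n → ℝ)

/-- For an observable pair, absence of nonzero undetectable inputs forces the initial state to vanish
as soon as the first `n` outputs do. -/
theorem Observable.eq_zero_of_output_eq_zero (h : Observable A C)
    (hno : ¬ ∃ u : ℕ → Fin p → ℝ, u ≠ 0 ∧ Undetectable A B C w u) {x : Fin n → ℝ}
    {u : ℕ → Fin p → ℝ} (hx : ∀ j < n, output A B C 0 x u j = 0) : x = 0 := by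
  obtain ⟨u', hu'⟩ := exists_input_output_eq_zero A B C hx
  have hu0 : u' = 0 := by
    by_contra hne
    exact hno ⟨u', hne, (undetectable_iff A B C w u').2 ⟨x, hu'⟩⟩
  subst hu0
  exact h x fun k => by rw [← output_noiseless_zero_input A B C, hu']

/-- If `B` is injective and only the zero state admits zero outputs over `n` steps, then the state
vanishes at all times under zero outputs, and so does the input. -/
theorem not_exists_undetectable (hB : Function.Injective B.mulVec)
    (h : ∀ (x : Fin n → ℝ) (u : ℕ → Fin p → ℝ), (∀ j < n, output A B C 0 x u j = 0) → x = 0) :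
    ¬ ∃ u : ℕ → Fin p → ℝ, u ≠ 0 ∧ Undetectable A B C w u := by
  rintro ⟨u, hu0, hu⟩
  rw [undetectable_iff] at hu
  obtain ⟨x, hx⟩ := hu
  have hzero : ∀ k (x : Fin n → ℝ) (u : ℕ → Fin p → ℝ), (∀ j, output A B C 0 x u j = 0) →
      u k = 0 := by
    have hfirst : ∀ (x : Fin n → ℝ) (u : ℕ → Fin p → ℝ), (∀ j, output A B C 0 x u j = 0) →
        A.mulVec x + B.mulVec (u 0) = 0 := fun x u hx =>
      h _ (fun j => u (j + 1)) fun j _ => by rw [← output_noiseless_succ, hx]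
    intro k
    induction k with
    | zero =>
      intro x u hx
      have h1 := hfirst x u hx
      rw [h x u fun j _ => hx j, Matrix.mulVec_zero, zero_add] at h1
      exact hB (by rw [h1, Matrix.mulVec_zero])
    | succ k ih =>
      intro x u hx
      exact ih _ (fun j => u (j + 1)) fun j => by rw [← output_noiseless_succ, hx]
  exact hu0 (funext fun k => hzero k x u hx)

/-- The rank condition says that the first `n` outputs vanish only from the zero initial state. -/
theorem rank_condition_iff [Fintype Y] [NeZero n] :
    ((Matrix.fromCols (obsMatrix A C (n - 1)) (inputMatrix A B C (n - 1))).rank : ℤ)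
        - ((inputMatrix A B C (n - 1)).rank : ℤ) = n ↔
      ∀ (x : Fin n → ℝ) (u : ℕ → Fin p → ℝ), (∀ j < n, output A B C 0 x u j = 0) → x = 0 := by
  have hn : n - 1 + 1 = n := Nat.sub_add_cancel NeZero.one_le
  have := rank_fromCols_sub_rank_eq_iff (obsMatrix A C (n - 1)) (inputMatrix A B C (n - 1))
  rw [Fintype.card_fin] at this
  rw [this]
  constructor
  · intro h x u hx
    refine h x (fun c => u c.1 c.2) ?_
    ext ⟨i, y⟩
    rw [obsMatrix_mulVec_add_inputMatrix_mulVec, hx _ (by omega)]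
    rfl
  · intro h x z hxz
    let u : ℕ → Fin p → ℝ := fun l q => if hl : l < n - 1 + 1 then z (⟨l, hl⟩, q) else 0
    have hu : z = fun c => u c.1 c.2 := by
      ext ⟨l, q⟩
      simp only [u, dif_pos l.2]
    refine h x u fun j hj => ?_
    ext y
    rw [hu] at hxz
    rw [← obsMatrix_mulVec_add_inputMatrix_mulVec A B C (n - 1) x u ⟨j, by omega⟩ y, hxz]
    rfl

/-- The equivalence for one realization: once the pair is observable, nothing else about the weights
matters. -/
theorem Observable.tfae [Fintype Y] [DecidableEq Y] [NeZero n] (h : Observable A C)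
    (hB : Function.Injective B.mulVec) :
    List.TFAE [
      ¬ ∃ u : ℕ → Fin p → ℝ, u ≠ 0 ∧ Undetectable A B C w u,
      ¬ ∃ u : ℕ → Fin p → ℝ, u ≠ 0 ∧ UndetectableByDetector A B C w u,
      ((Matrix.fromCols (obsMatrix A C (n - 1)) (inputMatrix A B C (n - 1))).rank : ℤ)
        - ((inputMatrix A B C (n - 1)).rank : ℤ) = n] := by
  rw [rank_condition_iff]
  tfae_have 1 → 2 := fun h1 ⟨u, hu0, hu⟩ =>
    h1 ⟨u, hu0, h.undetectable_of_undetectableByDetector B w hu⟩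
  tfae_have 2 → 1 := fun h2 ⟨u, hu0, hu⟩ =>
    h2 ⟨u, hu0, undetectableByDetector_of_undetectable B w hu⟩
  tfae_have 1 → 3 := fun h1 x u hx => h.eq_zero_of_output_eq_zero B w h1 hx
  tfae_have 3 → 1 := not_exists_undetectable B w hB
  tfae_finish

end System

theorem attackB_mulVec_injective {n p : ℕ} {atk : Fin p → Fin n} (h : Function.Injective atk) :
    Function.Injective (attackB atk).mulVec := by
  intro a b hab
  have key : ∀ (c : Fin p → ℝ) l, (attackB atk).mulVec c (atk l) = c l := by
    intro c l
    simp [Matrix.mulVec, dotProduct, attackB, h.eq_iff]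
  ext l
  rw [← key a, hab, key]


/-! ### Weighted Laplacians with a separating vertex -/

/-- The Laplacian of the symmetric edge weights `W`. -/
def laplacian {n : ℕ} (W : Matrix (Fin n) (Fin n) ℝ) : Matrix (Fin n) (Fin n) ℝ :=
  Matrix.diagonal (fun i => ∑ j, W i j) - W

section Laplacian

variable {n : ℕ} (W : Matrix (Fin n) (Fin n) ℝ)

theorem laplacian_mulVec_apply (x : Fin n → ℝ) (i : Fin n) :
    (laplacian W).mulVec x i = ∑ j, W i j * (x i - x j) := by
  rw [laplacian, Matrix.sub_mulVec, Pi.sub_apply, Matrix.mulVec_diagonal]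
  simp only [Matrix.mulVec, dotProduct, mul_sub, Finset.sum_sub_distrib, Finset.sum_mul]

theorem laplacian_add (W' : Matrix (Fin n) (Fin n) ℝ) :
    laplacian (W + W') = laplacian W + laplacian W' := by
  have : Matrix.diagonal (fun i => ∑ j, (W + W') i j) =
      Matrix.diagonal (fun i => ∑ j, W i j) + Matrix.diagonal (fun i => ∑ j, W' i j) := by
    rw [Matrix.diagonal_add]
    simp only [Matrix.add_apply, Finset.sum_add_distrib]
  rw [laplacian, this, laplacian, laplacian]
  abel

theorem laplacian_smul (t : ℝ) : laplacian (t • W) = t • laplacian W := by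
  rw [laplacian, laplacian, smul_sub, ← Matrix.diagonal_smul]
  congr 2
  ext i
  simp [Finset.mul_sum]

variable {W}

theorem laplacian_isHermitian (hW : W.IsSymm) : (laplacian W).IsHermitian := by
  rw [Matrix.IsHermitian, Matrix.conjTranspose_eq_transpose_of_trivial, laplacian,
    Matrix.transpose_sub, Matrix.diagonal_transpose, hW.eq]

theorem sum_laplacian_mulVec (hW : W.IsSymm) (x : Fin n → ℝ) :
    ∑ i, (laplacian W).mulVec x i = 0 := by
  have h : ∑ i, ∑ j, W i j * (x i - x j) = -∑ i, ∑ j, W i j * (x i - x j) := by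
    conv_lhs => rw [Finset.sum_comm]
    simp only [← Finset.sum_neg_distrib]
    refine Finset.sum_congr rfl fun i _ => Finset.sum_congr rfl fun j _ => ?_
    rw [hW.apply]
    ring
  simp only [laplacian_mulVec_apply]
  linarith

/-- An eigenvector of the Laplacian of `W` supported in `S` and vanishing at `s` is zero. -/
def Separating (W : Matrix (Fin n) (Fin n) ℝ) (S : Set (Fin n)) (s : Fin n) : Prop :=
  ∀ (x : Fin n → ℝ) (c : ℝ), (∀ i ∉ S, x i = 0) → x s = 0 →
    (laplacian W).mulVec x = c • x → x = 0

/-- The weights of a single edge `uv` of weight one. -/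
def singleEdge (u v : Fin n) : Matrix (Fin n) (Fin n) ℝ :=
  Matrix.single u v 1 + Matrix.single v u 1

theorem singleEdge_isSymm (u v : Fin n) : (singleEdge u v).IsSymm := by
  rw [Matrix.IsSymm, singleEdge, Matrix.transpose_add, Matrix.transpose_single,
    Matrix.transpose_single, add_comm]

theorem laplacian_singleEdge_mulVec {u v : Fin n} (x : Fin n → ℝ) :
    (laplacian (singleEdge u v)).mulVec x = (x u - x v) • (Pi.single u 1 - Pi.single v 1) := by
  ext i
  rw [laplacian_mulVec_apply]
  simp only [singleEdge, Matrix.add_apply, Matrix.single_apply, add_mul, Finset.sum_add_distrib,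
    Pi.smul_apply, Pi.sub_apply, Pi.single_apply, smul_eq_mul]
  by_cases h1 : i = u <;> by_cases h2 : i = v <;>
    simp [h1, h2, eq_comm, ite_and] <;> grind

/-- A separating vertex survives the attachment of a new vertex `v` by an edge of small weight. As
the weight tends to zero, unit eigenvectors violating the conclusion accumulate at an eigenvector of
the old Laplacian that is supported in `insert v S` and vanishes at `s`, hence is a multiple of the
indicator of `v`. But the violating vectors belong to nonzero eigenvalues, so their entries sum to
zero, and so do those of the limit. -/
theorem Separating.exists_insert {S : Set (Fin n)} {s u v : Fin n} (hW : W.IsSymm)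
    (hS : ∀ i j, W i j ≠ 0 → i ∈ S ∧ j ∈ S) (hsep : Separating W S s) (hs : s ∈ S)
    (hu : u ∈ S) (hv : v ∉ S) :
    ∃ t : ℝ, Separating (W + t • singleEdge u v) (insert v S) s := by
  have huv : u ≠ v := fun h => hv (h ▸ hu)
  have hsv : s ≠ v := fun h => hv (h ▸ hs)
  have hWv : ∀ j, W v j = 0 := fun j => by_contra fun h => hv (hS _ _ h).1
  have hvW : ∀ j, W j v = 0 := fun j => by_contra fun h => hv (hS _ _ h).2
  have hLv : ∀ x, (laplacian W).mulVec x v = 0 := fun x => by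
    simp [laplacian_mulVec_apply, hWv]
  -- The old Laplacian does not see the value at `v`.
  have hLupd : ∀ x, (laplacian W).mulVec (Function.update x v 0) = (laplacian W).mulVec x := by
    intro x
    ext i
    simp only [laplacian_mulVec_apply]
    refine Finset.sum_congr rfl fun j _ => ?_
    rcases eq_or_ne j v with rfl | hj
    · simp [hvW]
    · rcases eq_or_ne i v with rfl | hi
      · simp [hWv]
      · simp [hi, hj]
  have hLt : ∀ (t : ℝ) (x : Fin n → ℝ), (laplacian (W + t • singleEdge u v)).mulVec x =
      (laplacian W).mulVec x + (t * (x u - x v)) • (Pi.single u 1 - Pi.single v 1) := by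
    intro t x
    rw [laplacian_add, laplacian_smul, Matrix.add_mulVec, Matrix.smul_mulVec,
      laplacian_singleEdge_mulVec, smul_smul]
  have hsupp : ∀ x : Fin n → ℝ, (∀ i ∉ insert v S, x i = 0) →
      ∀ i ∉ S, Function.update x v 0 i = 0 := by
    intro x hx i hi
    rcases eq_or_ne i v with rfl | hne
    · simp
    · rw [Function.update_of_ne hne]
      exact hx i fun h => h.elim hne hi
  by_contra! hbad
  have hex : ∀ t : ℝ, t ≠ 0 → ∃ x : Fin n → ℝ, x ∈ Metric.sphere (0 : Fin n → ℝ) 1 ∧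
      (∀ i ∉ insert v S, x i = 0) ∧ x s = 0 ∧ ∑ i, x i = 0 ∧
      ∃ c : ℝ, (laplacian (W + t • singleEdge u v)).mulVec x = c • x := by
    intro t ht
    have h := hbad t
    simp only [Separating, not_forall] at h
    obtain ⟨x, c, hx, hxs, hxc, hx0⟩ := h
    have hc : c ≠ 0 := by
      rintro rfl
      rw [zero_smul] at hxc
      have h1 := congrFun hxc v
      rw [hLt] at h1
      have h2 : x u = x v := by
        simp only [Pi.add_apply, hLv, Pi.smul_apply, Pi.sub_apply, Pi.single_eq_same,
          Pi.single_eq_of_ne huv.symm, smul_eq_mul, Pi.zero_apply] at h1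
        have : t * (x u - x v) = 0 := by linarith
        have := (mul_eq_zero.1 this).resolve_left ht
        linarith
      rw [hLt, h2, sub_self, mul_zero, zero_smul, add_zero, ← hLupd] at hxc
      have h3 := hsep _ 0 (hsupp x hx) (by rw [Function.update_of_ne hsv, hxs])
        (by rw [hxc, zero_smul])
      have hux : x u = 0 := by
        have := congrFun h3 u
        rwa [Function.update_of_ne huv] at this
      apply hx0
      ext i
      rcases eq_or_ne i v with rfl | hi
      · rw [← h2, hux]; rfl
      · have := congrFun h3 i
        rwa [Function.update_of_ne hi] at this
    have hsum : ∑ i, x i = 0 := by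
      have h1 := sum_laplacian_mulVec (W := W + t • singleEdge u v)
        (hW.add ((singleEdge_isSymm u v).smul t)) x
      rw [hxc] at h1
      simp only [Pi.smul_apply, smul_eq_mul, ← Finset.mul_sum] at h1
      exact (mul_eq_zero.1 h1).resolve_left hc
    have hnorm : ‖x‖ ≠ 0 := norm_ne_zero_iff.2 hx0
    refine ⟨‖x‖⁻¹ • x, ?_, fun i hi => ?_, ?_, ?_, c, ?_⟩
    · rw [mem_sphere_zero_iff_norm, norm_smul, norm_inv, norm_norm, inv_mul_cancel₀ hnorm]
    · simp [hx i hi]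
    · simp [hxs]
    · simp only [Pi.smul_apply, smul_eq_mul, ← Finset.mul_sum, hsum, mul_zero]
    · rw [Matrix.mulVec_smul, hxc, smul_comm]
  have ht : ∀ k : ℕ, (1 / ((k : ℝ) + 1)) ≠ 0 := fun k => by positivity
  choose y hy hysupp hys hysum c hyc using fun k : ℕ => hex _ (ht k)
  obtain ⟨x, hx, φ, hφ, hlim⟩ := (isCompact_sphere (0 : Fin n → ℝ) 1).tendsto_subseq hy
  have htlim := (tendsto_one_div_add_atTop_nhds_zero_nat (𝕜 := ℝ)).comp hφ.tendsto_atTop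
  have hpair := htlim.prodMk_nhds hlim
  have hcoord : ∀ i, Filter.Tendsto (fun k => y (φ k) i) Filter.atTop (nhds (x i)) := fun i =>
    (tendsto_pi_nhds.1 hlim) i
  have hxsupp : ∀ i ∉ insert v S, x i = 0 := fun i hi =>
    tendsto_nhds_unique (hcoord i) (by simp [hysupp _ i hi])
  have hxs : x s = 0 := tendsto_nhds_unique (hcoord s) (by simp [hys])
  have hxsum : ∑ i, x i = 0 :=
    tendsto_nhds_unique (tendsto_finsetSum _ fun i _ => hcoord i) (by simp [hysum])
  -- The Rayleigh form of the eigenvector equation has no eigenvalue in it, so it passes to limits.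
  have hclosed : IsClosed {q : ℝ × (Fin n → ℝ) |
      (q.2 ⬝ᵥ q.2) • (laplacian (W + q.1 • singleEdge u v)).mulVec q.2 =
        (q.2 ⬝ᵥ (laplacian (W + q.1 • singleEdge u v)).mulVec q.2) • q.2} := by
    simp only [hLt]
    apply isClosed_eq <;> simp only [dotProduct] <;> fun_prop
  have hmem := hclosed.mem_of_tendsto hpair (Filter.Eventually.of_forall fun k => by
    simp only [Function.comp_apply, Set.mem_ofPred_eq, hyc, dotProduct_smul, smul_smul, smul_eq_mul]
    rw [mul_comm])
  have hx0 : x ≠ 0 := by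
    rintro rfl
    simp at hx
  have hxx : x ⬝ᵥ x ≠ 0 := fun h => hx0 (dotProduct_self_eq_zero.1 h)
  simp only [Set.mem_ofPred_eq, zero_smul, add_zero] at hmem
  obtain ⟨c, hxc⟩ : ∃ c : ℝ, (laplacian W).mulVec x = c • x := by
    refine ⟨(x ⬝ᵥ x)⁻¹ * (x ⬝ᵥ (laplacian W).mulVec x), ?_⟩
    rw [mul_smul, ← hmem, smul_smul, inv_mul_cancel₀ hxx, one_smul]
  have hcv : c * x v = 0 := by
    have := congrFun hxc v
    rw [hLv] at this
    simpa using this.symm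
  have hupd : Function.update x v 0 = 0 := by
    refine hsep _ c (hsupp x hxsupp) (by rw [Function.update_of_ne hsv, hxs]) ?_
    rw [hLupd, hxc]
    ext i
    rcases eq_or_ne i v with rfl | hi
    · simpa using hcv
    · simp [hi]
  have hxi : ∀ i, i ≠ v → x i = 0 := fun i hi => by
    have := congrFun hupd i
    rwa [Function.update_of_ne hi] at this
  have hxv : x v = 0 := by
    rwa [Finset.sum_eq_single v (fun i _ hi => hxi i hi) (by simp)] at hxsum
  exact hx0 (funext fun i => (eq_or_ne i v).elim (fun h => h ▸ hxv) (hxi i))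

/-- A connected graph carries symmetric weights, supported on its edges, for which no nonzero
Laplacian eigenvector vanishes at `s`. -/
theorem exists_separating {G : SimpleGraph (Fin n)} (hG : G.Connected) (s : Fin n) :
    ∃ W : Matrix (Fin n) (Fin n) ℝ, W.IsSymm ∧ (∀ i j, W i j ≠ 0 → G.Adj i j) ∧
      Separating W Set.univ s := by
  classical
  let P : Finset (Fin n) → Prop := fun S => s ∈ S ∧ ∃ W : Matrix (Fin n) (Fin n) ℝ, W.IsSymm ∧
    (∀ i j, W i j ≠ 0 → G.Adj i j) ∧ (∀ i j, W i j ≠ 0 → i ∈ S ∧ j ∈ S) ∧ Separating W S s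
  have h0 : P {s} := by
    refine ⟨by simp, 0, Matrix.isSymm_zero, by simp, by simp, fun x c hx hxs _ => ?_⟩
    ext i
    rcases eq_or_ne i s with rfl | hi
    · exact hxs
    · exact hx i (by simpa using hi)
  obtain ⟨S, hPS, hmax⟩ := Finset.exists_max_image (Finset.univ.filter P) Finset.card
    ⟨{s}, by simpa using h0⟩
  obtain ⟨hsS, W, hW, hadj, hWS, hsep⟩ := (Finset.mem_filter.1 hPS).2
  suffices hSu : S = Finset.univ by
    subst hSu
    exact ⟨W, hW, hadj, by simpa using hsep⟩
  by_contra hne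
  obtain ⟨z, hz⟩ : ∃ z, z ∉ S := by
    by_contra! h
    exact hne (Finset.eq_univ_iff_forall.2 h)
  obtain ⟨⟨⟨u, v⟩, huv⟩, -, hu, hv⟩ :=
    (hG.preconnected s z).some.exists_boundary_dart (S : Set (Fin n)) hsS hz
  simp only [Finset.mem_coe] at hu hv
  obtain ⟨t, ht⟩ := hsep.exists_insert hW (by simpa using hWS) (by simpa using hsS)
    (by simpa using hu) (by simpa using hv)
  have hnew : ∀ i j, (W + t • singleEdge u v) i j ≠ 0 →
      W i j ≠ 0 ∨ (i = u ∧ j = v) ∨ (i = v ∧ j = u) := by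
    intro i j h
    contrapose! h
    have h1 : ¬ (u = i ∧ v = j) := fun e => h.2.1 e.1.symm e.2.symm
    have h2 : ¬ (v = i ∧ u = j) := fun e => h.2.2 e.1.symm e.2.symm
    simp [singleEdge, h.1, h1, h2]
  have hP : P (insert v S) := by
    refine ⟨Finset.mem_insert_of_mem hsS, W + t • singleEdge u v,
      hW.add ((singleEdge_isSymm u v).smul t), fun i j h => ?_, fun i j h => ?_, ?_⟩
    · rcases hnew i j h with h | ⟨rfl, rfl⟩ | ⟨rfl, rfl⟩
      exacts [hadj i j h, huv, huv.symm]
    · rcases hnew i j h with h | ⟨rfl, rfl⟩ | ⟨rfl, rfl⟩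
      · exact ⟨Finset.mem_insert_of_mem (hWS i j h).1, Finset.mem_insert_of_mem (hWS i j h).2⟩
      · simp [hu]
      · simp [hu]
    · simpa using ht
  have hcard := hmax (insert v S) (by simpa using hP)
  rw [Finset.card_insert_of_notMem hv] at hcard
  omega

end Laplacian

/-! ### Generic observability -/

/-- The eigenvector test for observability of a symmetric matrix: the unobservable states form an
invariant subspace, on which the matrix, being symmetric, has an eigenvector unless it is zero. -/
theorem observable_of_eigenvectors {n : ℕ} {Y : Type*} {A : Matrix (Fin n) (Fin n) ℝ}
    {C : Matrix Y (Fin n) ℝ} (hA : A.IsHermitian)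
    (h : ∀ (x : Fin n → ℝ) (c : ℝ), A.mulVec x = c • x → C.mulVec x = 0 → x = 0) :
    Observable A C := by
  intro x₀ hx₀
  by_contra hne
  let T := A.toEuclideanLin
  have hT : T.IsSymmetric := Matrix.isSymmetric_toEuclideanLin_iff.2 hA
  let V : Submodule ℝ (EuclideanSpace ℝ (Fin n)) :=
    { carrier := {x | ∀ k : ℕ, (C * A ^ k).mulVec x.ofLp = 0}
      zero_mem' := fun k => by simp
      add_mem' := fun {a b} ha hb k => by
        rw [WithLp.ofLp_add, Matrix.mulVec_add, ha k, hb k, add_zero]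
      smul_mem' := fun r a ha k => by
        rw [WithLp.ofLp_smul, Matrix.mulVec_smul, ha k, smul_zero] }
  have hV : ∀ x ∈ V, T x ∈ V := by
    intro x hx k
    have h1 : (T x).ofLp = A.mulVec x.ofLp := rfl
    rw [h1, Matrix.mulVec_mulVec, Matrix.mul_assoc, ← pow_succ]
    exact hx (k + 1)
  have hnt : Nontrivial V := by
    refine ⟨⟨⟨WithLp.toLp 2 x₀, hx₀⟩, 0, fun h0 => hne ?_⟩⟩
    exact congrArg (fun z : V => z.1.ofLp) h0
  obtain ⟨z, hz⟩ :=
    (hT.restrict_invariant hV).hasEigenvalue_iSup_of_finiteDimensional.exists_hasEigenvector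
  have hz0 : z.1.ofLp = 0 := by
    refine h _ _ (congrArg (fun z : V => z.1.ofLp) hz.apply_eq_smul) ?_
    simpa using z.2 0
  refine hz.2 (Subtype.ext ?_)
  exact congrArg (WithLp.toLp 2) hz0

section Network

variable {n : ℕ} (G : SimpleGraph (Fin n)) [DecidableRel G.Adj]

/-- The symmetric matrix with prescribed edge weights, and zero away from the edges, in particular on
the diagonal. -/
def ofEdgeWeights (w : Edge G → ℝ) : Matrix (Fin n) (Fin n) ℝ :=
  Matrix.of fun i j =>
    if h : i < j ∧ G.Adj i j then w ⟨(i, j), h⟩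
    else if h : j < i ∧ G.Adj j i then w ⟨(j, i), h⟩ else 0

variable {G}

theorem ofEdgeWeights_edgeWeights {M : Matrix (Fin n) (Fin n) ℝ} (hM : M.IsSymm)
    (hadj : ∀ i j, i ≠ j → M i j ≠ 0 → G.Adj i j) {i j : Fin n} (hij : i ≠ j) :
    ofEdgeWeights G (edgeWeights G M) i j = M i j := by
  simp only [ofEdgeWeights, edgeWeights, Matrix.of_apply]
  split_ifs with h1 h2
  · rfl
  · exact hM.apply i j
  · by_contra hne
    have h := hadj i j hij (Ne.symm hne)
    rcases lt_or_gt_of_ne hij with hlt | hlt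
    exacts [h1 ⟨hlt, h⟩, h2 ⟨hlt, h.symm⟩]

/-- The row sums being one, the edge weights determine the whole weight matrix. -/
theorem IsWeightMatrix.eq_one_sub_laplacian {A : Matrix (Fin n) (Fin n) ℝ}
    (hA : IsWeightMatrix G A) : A = 1 - laplacian (ofEdgeWeights G (edgeWeights G A)) := by
  have hsymm : A.IsSymm := by
    have := hA.symm
    rwa [Matrix.IsHermitian, Matrix.conjTranspose_eq_transpose_of_trivial] at this
  have hoff : ∀ i j, i ≠ j → ofEdgeWeights G (edgeWeights G A) i j = A i j := fun i j hij =>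
    ofEdgeWeights_edgeWeights hsymm (fun i j hij => (hA.support i j hij).1) hij
  have hdiag : ∀ i, ofEdgeWeights G (edgeWeights G A) i i = 0 := fun i => by
    simp [ofEdgeWeights]
  ext i j
  rcases eq_or_ne i j with rfl | hij
  · have h1 : ∑ j, A i j = 1 := by
      have := congrFun hA.ones i
      simpa [Matrix.mulVec, dotProduct] using this
    rw [← Finset.add_sum_erase _ _ (Finset.mem_univ i)] at h1
    have h2 : ∑ j, ofEdgeWeights G (edgeWeights G A) i j = ∑ j ∈ Finset.univ.erase i, A i j := by
      rw [← Finset.add_sum_erase _ _ (Finset.mem_univ i), hdiag, zero_add]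
      exact Finset.sum_congr rfl fun j hj => hoff i j (Finset.ne_of_mem_erase hj).symm
    simp only [laplacian, Matrix.sub_apply, Matrix.one_apply_eq, Matrix.diagonal_apply_eq, hdiag, h2]
    linarith
  · simp [laplacian, Matrix.sub_apply, Matrix.one_apply_ne hij, Matrix.diagonal_apply_ne _ hij,
      hoff i j hij]

/-- Some edge weights make the network observable from agent `s`. -/
theorem exists_observable (hG : G.Connected) (s : Fin n) :
    ∃ w : Edge G → ℝ, Observable (1 - laplacian (ofEdgeWeights G w)) (obsC G s) := by
  obtain ⟨W, hW, hadj, hsep⟩ := exists_separating hG s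
  refine ⟨edgeWeights G W, ?_⟩
  have hWW : ofEdgeWeights G (edgeWeights G W) = W := by
    ext i j
    rcases eq_or_ne i j with rfl | hij
    · have : W i i = 0 := by_contra fun h => G.irrefl (hadj i i h)
      simp [ofEdgeWeights, this]
    · exact ofEdgeWeights_edgeWeights hW (fun i j _ => hadj i j) hij
  rw [hWW]
  refine observable_of_eigenvectors (Matrix.isHermitian_one.sub (laplacian_isHermitian hW)) ?_
  intro x c hx hCx
  refine hsep x (1 - c) (by simp) ?_ ?_
  · have := congrFun hCx ⟨s, Or.inl rfl⟩
    simpa [Matrix.mulVec, dotProduct, obsC] using this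
  · rw [Matrix.sub_mulVec, Matrix.one_mulVec] at hx
    rw [sub_smul, one_smul, ← hx, sub_sub_cancel]

theorem analyticAt_ofEdgeWeights (i j : Fin n) (w : Edge G → ℝ) :
    AnalyticAt ℝ (fun w => ofEdgeWeights G w i j) w := by
  have hproj : ∀ e : Edge G, AnalyticAt ℝ (fun w : Edge G → ℝ => w e) w := fun e =>
    (ContinuousLinearMap.proj (R := ℝ) (φ := fun _ : Edge G => ℝ) e).analyticAt w
  simp only [ofEdgeWeights, Matrix.of_apply]
  split_ifs
  exacts [hproj _, hproj _, analyticAt_const]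

theorem analyticOnNhd_det_gram {Y : Type*} [Fintype Y] (C : Matrix Y (Fin n) ℝ) (N : ℕ) :
    AnalyticOnNhd ℝ (fun w : Edge G → ℝ =>
      ((obsMatrix (1 - laplacian (ofEdgeWeights G w)) C N).transpose *
        obsMatrix (1 - laplacian (ofEdgeWeights G w)) C N).det) Set.univ := by
  intro w _
  have hL : ∀ i j, AnalyticAt ℝ
      (fun w => (1 - laplacian (ofEdgeWeights G w) : Matrix (Fin n) (Fin n) ℝ) i j) w := by
    intro i j
    simp only [laplacian, Matrix.sub_apply, Matrix.diagonal_apply]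
    refine analyticAt_const.fun_sub (AnalyticAt.fun_sub ?_ (analyticAt_ofEdgeWeights i j w))
    split_ifs
    · exact Finset.analyticAt_fun_sum _ fun k _ => analyticAt_ofEdgeWeights i k w
    · exact analyticAt_const
  have hpow : ∀ (k : ℕ) i j, AnalyticAt ℝ
      (fun w => ((1 - laplacian (ofEdgeWeights G w)) ^ k : Matrix (Fin n) (Fin n) ℝ) i j) w := by
    intro k
    induction k with
    | zero => intro i j; simpa using analyticAt_const
    | succ k ih =>
      intro i j
      simp only [pow_succ, Matrix.mul_apply]
      exact Finset.analyticAt_fun_sum _ fun l _ => (ih i l).fun_mul (hL l j)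
  have hO : ∀ r j, AnalyticAt ℝ
      (fun w => obsMatrix (1 - laplacian (ofEdgeWeights G w)) C N r j) w := by
    intro r j
    simp only [obsMatrix, Matrix.of_apply, Matrix.mul_apply]
    exact Finset.analyticAt_fun_sum _ fun l _ => analyticAt_const.fun_mul (hpow _ l j)
  simp only [Matrix.det_apply, Matrix.mul_apply, Matrix.transpose_apply, zsmul_eq_mul, Units.smul_def]
  refine Finset.analyticAt_fun_sum _ fun σ _ => analyticAt_const.fun_mul ?_
  refine Finset.analyticAt_fun_prod _ fun i _ => ?_
  exact Finset.analyticAt_fun_sum _ fun r _ => (hO r _).fun_mul (hO r _)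

/-- Observability from an agent of a connected network fails only for a null set of edge weights:
its failure is the vanishing of a Gram determinant, which is an analytic function of the weights and
does not vanish identically. -/
theorem ae_observable [NeZero n] (hG : G.Connected) (s : Fin n) :
    ∀ᵐ w : Edge G → ℝ, Observable (1 - laplacian (ofEdgeWeights G w)) (obsC G s) := by
  obtain ⟨w₀, hw₀⟩ := exists_observable hG s
  simp only [observable_iff_det_ne_zero] at hw₀ ⊢
  exact ae_ne_zero_of_analyticOnNhd volume (analyticOnNhd_det_gram (obsC G s) (n - 1)) hw₀

end Network

end Consensus

theorem mainTheorem1 {Ω : Type*} [MeasurableSpace Ω] (ℙ : Measure Ω) [IsProbabilityMeasure ℙ]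
    {n : ℕ} [NeZero n] (G : SimpleGraph (Fin n)) [DecidableRel G.Adj] (hG : G.Connected)
    (A : Ω → Matrix (Fin n) (Fin n) ℝ)
    (hAm : ∀ i j, Measurable fun ω => A ω i j)
    (hA : ∀ᵐ ω ∂ℙ, Consensus.IsWeightMatrix G (A ω))
    (hAc : ℙ.map (fun ω => Consensus.edgeWeights G (A ω)) ≪ volume) :
    ∀ᵐ ω ∂ℙ, ∀ (p : ℕ) (atk : Fin p → Fin n), Function.Injective atk →
      ∀ (φ : ℝ), 0 < φ → φ < 1 → ∀ v : ℕ → Fin n → ℝ,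
      List.TFAE [
        ¬ ∃ u : ℕ → Fin p → ℝ, u ≠ 0 ∧
          Consensus.Undetectable (A ω) (Consensus.attackB atk) (Consensus.obsC G 0)
            (Consensus.privacyNoise φ v) u,
        ¬ ∃ u : ℕ → Fin p → ℝ, u ≠ 0 ∧
          Consensus.UndetectableByDetector (A ω) (Consensus.attackB atk) (Consensus.obsC G 0)
            (Consensus.privacyNoise φ v) u,
        ((Matrix.fromCols
            (Consensus.obsMatrix (A ω) (Consensus.obsC G 0) (n - 1))
            (Consensus.inputMatrix (A ω) (Consensus.attackB atk) (Consensus.obsC G 0)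
              (n - 1))).rank : ℤ)
          - ((Consensus.inputMatrix (A ω) (Consensus.attackB atk) (Consensus.obsC G 0)
              (n - 1)).rank : ℤ) = n] := by

  have hmeas : Measurable fun ω => Consensus.edgeWeights G (A ω) :=
    measurable_pi_lambda _ fun e => hAm _ _
  have hobs := ae_of_ae_map hmeas.aemeasurable (hAc.ae_le (Consensus.ae_observable hG 0))
  filter_upwards [hA, hobs] with ω hω hobsω p atk hatk φ _ _ v
  rw [← hω.eq_one_sub_laplacian] at hobsω
  exact hobsω.tfae _ _ (Consensus.attackB_mulVec_injective hatk)
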